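/- There is an absolute constant $K>0$ such that the following holds. Let $n=2m$ be even and let $$C=\begin{pmatrix}0&B\\ B^T&0\end{pmatrix}\in\mathbb{R}^{n\times n},\qquad B\in\mathbb{R}^{m\times m},$$ have operator (spectral) norm $\|C\|=1$. Let $\rho^\star$ maximize $\operatorname{tr}(C\rho)$ over all symmetric positive semidefinite $\rho\in\mathbb{R}^{n\times n}$ with $\rho_{ii}=1/n$ for all $i$. Let $0\le\epsilon\le 1/2$ and let $\rho\in\mathbb{R}^{n\times n}$ be symmetric positive semidefinite with $$\operatorname{tr}(C\rho^\star)-\operatorname{tr}(C\rho)\le\epsilon\qquad\text{and}\qquad \sum_{i=1}^n\Big|\rho_{ii}-\frac1n\Big|\le\epsilon .$$ Let $g_1,\dots,g_n$ be independent standard normal random variables, let $\sqrt{\rho}$ be the positive semidefinite square root of $\rho$, and let $x\in\{-1,1\}^n$ be given by $x_i=\operatorname{sgn}\big(\sum_j(\sqrt\rho)_{ij}\,g_j\big)$, where $\operatorname{sgn}(t)=1$ for $t\ge0$ and $\operatorname{sgn}(t)=-1$ for $t<0$. Then $$\mathbb{E}\big[x^TCx\big]\;\ge\;\Big(\frac4\pi-1\Big)\,n\,\operatorname{tr}(C\rho^\star)\;-\;K\,n\,\epsilon^{1/3}.$$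 -/

import Mathlib

open scoped MatrixOrder

noncomputable section

/-- The symmetric block matrix with zero diagonal blocks and off-diagonal blocks `B` and `Bᵀ`. -/
def bipartiteCost {m : ℕ} (B : Matrix (Fin m) (Fin m) ℝ) :
    Matrix (Fin m ⊕ Fin m) (Fin m ⊕ Fin m) ℝ :=
  Matrix.fromBlocks 0 B B.transpose 0

/-- Operator (spectral) norm of a real square matrix, with respect to the Euclidean norm. -/
def opNorm {ι : Type*} [Fintype ι] [DecidableEq ι] (A : Matrix ι ι ℝ) : ℝ :=
  ‖Matrix.toEuclideanCLM (n := ι) (𝕜 := ℝ) A‖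

/-- Feasible points of the renormalized semidefinite relaxation: positive semidefinite (hence
symmetric) matrices of size `n = card ι` all of whose diagonal entries are `1 / n`. -/
def SDPFeasible {ι : Type*} [Fintype ι] (ρ : Matrix ι ι ℝ) : Prop :=
  ρ.PosSemidef ∧ ∀ i, ρ i i = 1 / (Fintype.card ι : ℝ)

/-- `ρ` maximizes `tr (C ρ)` over the feasible points of the semidefinite relaxation. -/
def IsSDPOptimal {ι : Type*} [Fintype ι] (C ρ : Matrix ι ι ℝ) : Prop :=
  SDPFeasible ρ ∧ ∀ τ : Matrix ι ι ℝ, SDPFeasible τ → (C * τ).trace ≤ (C * ρ).trace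

/-- The `±1`-valued sign function; ties at `0` are broken towards `1`. -/
def sgn (t : ℝ) : ℝ := if 0 ≤ t then 1 else -1

/-- The sign vector `x i = sgn (∑ j, (√ρ) i j * g j)`, where `√ρ` is the positive semidefinite
square root. -/
def signRound {ι : Type*} [Fintype ι] [DecidableEq ι] (ρ : Matrix ι ι ℝ) (g : ι → ℝ) : ι → ℝ :=
  fun i => sgn (∑ j, (CFC.sqrt ρ) i j * g j)

/-- The law of a vector of independent standard normal random variables. -/
def stdGaussianVec (ι : Type*) [Fintype ι] : MeasureTheory.Measure (ι → ℝ) :=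
  MeasureTheory.Measure.pi fun _ => ProbabilityTheory.gaussianReal 0 1

/-- `E[xᵀ C x]` for the vector `x` obtained by randomized rounding of `ρ`. -/
def expectedRoundedValue {ι : Type*} [Fintype ι] [DecidableEq ι] (C ρ : Matrix ι ι ℝ) : ℝ :=
  ∫ g, dotProduct (signRound ρ g) (C.mulVec (signRound ρ g)) ∂(stdGaussianVec ι)

theorem sgn_eq_one_or (t : ℝ) : sgn t = 1 ∨ sgn t = -1 := by
  unfold sgn; split_ifs <;> simp

/-- The integrand defining `expectedRoundedValue` is integrable. -/
theorem integrable_roundedValue {ι : Type*} [Fintype ι] [DecidableEq ι] (C ρ : Matrix ι ι ℝ) :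
    MeasureTheory.Integrable
      (fun g => dotProduct (signRound ρ g) (C.mulVec (signRound ρ g))) (stdGaussianVec ι) := by
  have : MeasureTheory.IsProbabilityMeasure (stdGaussianVec ι) := by
    unfold stdGaussianVec; infer_instance
  have hs : Measurable sgn := by
    unfold sgn
    exact Measurable.ite measurableSet_Ici measurable_const measurable_const
  have hx : ∀ i, Measurable fun g : ι → ℝ => signRound ρ g i := by
    intro i
    unfold signRound
    exact hs.comp (by fun_prop)
  have hb : ∀ (g : ι → ℝ) i, |signRound ρ g i| = 1 := by
    intro g i
    rcases sgn_eq_one_or (∑ j, (CFC.sqrt ρ) i j * g j) with h | h <;> simp [signRound, h]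
  simp only [dotProduct, Matrix.mulVec, Finset.mul_sum]
  refine MeasureTheory.integrable_finsetSum _ fun i _ =>
    MeasureTheory.integrable_finsetSum _ fun j _ => ?_
  refine MeasureTheory.Integrable.of_bound (C := |C i j|) ?_ (Filter.Eventually.of_forall ?_)
  · exact ((hx i).mul (measurable_const.mul (hx j))).aestronglyMeasurable
  · intro g
    simp [hb]

end

open MeasureTheory ProbabilityTheory

/-! Let `A = √ρ` have rows `u_i`, with unit vectors `û_i`. The sign of `⟨u_i, g⟩` splits as `√(2/π)
⟨û_i, g⟩` plus a residual orthogonal to every linear form in `g` (`integral_sgn_mul_dotProduct`), so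
`E[x_i x_j] = (2/π) ⟨û_i, û_j⟩ + R_ij`, where `R` is positive semidefinite with diagonal `1 - 2/π`.

The cost changes sign when the signs on one side of the bipartition are flipped, so feasibility of
the flipped, rescaled `R` bounds its value below by `-(1 - 2/π) n tr(Cρ*)` (`neg_optimum_le_sum`).
The Gram matrix of the `û_i` is close to `nρ`, since the diagonal of `nρ` is close to 1 in ℓ¹ and
`‖C‖ = 1` (`scaled_sum_sub_unitVec_le`); its value is at least `n tr(Cρ*) - O(n√ε)`. Adding, `2/π -
(1 - 2/π) = 4/π - 1`. The error obtained is `O(n√ε)`, stronger than the required `O(n ε^(1/3))`. -/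

instance isProbabilityMeasure_stdGaussianVec {ι : Type*} [Fintype ι] :
    IsProbabilityMeasure (stdGaussianVec ι) := by
  unfold stdGaussianVec; infer_instance

/-! ### The sign function and the first absolute Gaussian moment -/

theorem measurable_sgn : Measurable sgn := by
  unfold sgn
  exact Measurable.ite measurableSet_Ici measurable_const measurable_const

theorem abs_sgn (t : ℝ) : |sgn t| = 1 := by
  rcases sgn_eq_one_or t with h | h <;> simp [h]

theorem sgn_mul_self (t : ℝ) : sgn t * t = |t| := by
  unfold sgn
  split_ifs with h
  · rw [abs_of_nonneg h, one_mul]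
  · rw [abs_of_neg (not_le.mp h), neg_one_mul]

theorem sgn_pos_mul {c : ℝ} (hc : 0 < c) (t : ℝ) : sgn (c * t) = sgn t := by
  simp only [sgn, mul_nonneg_iff_of_pos_left hc]

/-- The first absolute moment of a standard normal variable. -/
theorem integral_abs_gaussianReal : ∫ x, |x| ∂(gaussianReal 0 1) = √(2 / Real.pi) := by
  rw [integral_gaussianReal_eq_integral_smul one_ne_zero]
  have h1 : ∀ x : ℝ, gaussianPDFReal 0 1 x • |x|
      = (√(2 * Real.pi))⁻¹ * (|x| * Real.exp (-(1 / 2) * |x| ^ 2)) := by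
    intro x
    simp only [gaussianPDFReal_def, smul_eq_mul, sq_abs]
    norm_num
    ring_nf
  simp_rw [h1]
  rw [integral_const_mul, integral_comp_abs (f := fun x => x * Real.exp (-(1 / 2) * x ^ 2))]
  have h2 := integral_rpow_mul_exp_neg_mul_rpow (p := 2) (q := 1) (b := 1 / 2)
    (by norm_num) (by norm_num) (by norm_num)
  have h3 : ∫ x in Set.Ioi (0 : ℝ), x * Real.exp (-(1 / 2) * x ^ 2) = 1 := by
    have : (1 / 2 : ℝ) ^ (-(1 + 1) / 2 : ℝ) = 2 := by
      rw [show (-(1 + 1) / 2 : ℝ) = -1 by norm_num, Real.rpow_neg_one]; norm_num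
    rw [this, show ((1 : ℝ) + 1) / 2 = 1 by norm_num, Real.Gamma_one] at h2
    norm_num at h2 ⊢
    exact h2
  rw [h3, mul_one, Real.sqrt_mul (by norm_num), Real.sqrt_div (by norm_num)]
  have := Real.sqrt_pos.mpr Real.pi_pos
  have h2' : √(2 : ℝ) ≠ 0 := by positivity
  field_simp
  norm_num

/-! ### Gaussian linear forms and their signs -/

section Linear

variable {ι : Type*} [Fintype ι]

theorem hasGaussianLaw_id_stdGaussianVec :
    HasGaussianLaw (fun g : ι → ℝ => g) (stdGaussianVec ι) := by
  refine iIndepFun.hasGaussianLaw (X := fun i (g : ι → ℝ) => g i) (fun i => ?_) ?_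
  · exact ((measurePreserving_eval (fun _ : ι => gaussianReal 0 1) i).hasLaw).hasGaussianLaw
  · exact iIndepFun_pi (X := fun _ x => x) (fun i => aemeasurable_id)

theorem hasGaussianLaw_dotProduct (u : ι → ℝ) :
    HasGaussianLaw (fun g : ι → ℝ => u ⬝ᵥ g) (stdGaussianVec ι) :=
  hasGaussianLaw_id_stdGaussianVec.map_fun
    (LinearMap.toContinuousLinearMap (dotProductBilin ℝ ℝ u))

/-- Joint Gaussianity is what lets zero covariance imply independence in
`integral_sgn_mul_dotProduct`. -/
theorem hasGaussianLaw_dotProduct_prod (u v : ι → ℝ) :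
    HasGaussianLaw (fun g : ι → ℝ => (u ⬝ᵥ g, v ⬝ᵥ g)) (stdGaussianVec ι) :=
  hasGaussianLaw_id_stdGaussianVec.map_fun
    ((LinearMap.toContinuousLinearMap (dotProductBilin ℝ ℝ u)).prod
      (LinearMap.toContinuousLinearMap (dotProductBilin ℝ ℝ v)))

theorem memLp_dotProduct (u : ι → ℝ) :
    MemLp (fun g : ι → ℝ => u ⬝ᵥ g) 2 (stdGaussianVec ι) :=
  (hasGaussianLaw_dotProduct u).memLp_two

theorem measurable_dotProduct (u : ι → ℝ) : Measurable (fun g : ι → ℝ => u ⬝ᵥ g) := by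
  unfold dotProduct; fun_prop

theorem memLp_sgn_dotProduct (u : ι → ℝ) :
    MemLp (fun g : ι → ℝ => sgn (u ⬝ᵥ g)) 2 (stdGaussianVec ι) :=
  MemLp.of_bound (measurable_sgn.comp (measurable_dotProduct u)).aestronglyMeasurable 1
    (Filter.Eventually.of_forall fun g => by simp [abs_sgn])

theorem memLp_eval (i : ι) : MemLp (fun g : ι → ℝ => g i) 2 (stdGaussianVec ι) :=
  (hasGaussianLaw_id_stdGaussianVec.eval i).memLp_two

theorem integral_eval_stdGaussianVec (i : ι) : ∫ g : ι → ℝ, g i ∂(stdGaussianVec ι) = 0 := by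
  have h := measurePreserving_eval (fun _ : ι => gaussianReal 0 1) i
  have := h.hasLaw.integral_eq
  simpa [stdGaussianVec] using this

theorem integral_eval_mul_eval [DecidableEq ι] (i j : ι) :
    ∫ g : ι → ℝ, g i * g j ∂(stdGaussianVec ι) = if i = j then 1 else 0 := by
  split_ifs with hij
  · subst hij
    have h := (measurePreserving_eval (fun _ : ι => gaussianReal 0 1) i).hasLaw.variance_eq
    have h2 := variance_eq_sub (memLp_eval i)
    rw [integral_eval_stdGaussianVec] at h2
    rw [variance_id_gaussianReal] at h
    simp only [Pi.pow_apply] at h2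
    have h3 : Var[fun g : ι → ℝ => g i; stdGaussianVec ι] = 1 := h
    rw [h3] at h2
    simp_rw [← pow_two]
    linarith
  · have h : iIndepFun (fun i (g : ι → ℝ) => g i) (stdGaussianVec ι) :=
      iIndepFun_pi (X := fun _ x => x) (fun i => aemeasurable_id)
    rw [(h.indepFun hij).integral_fun_mul_eq_mul_integral
      (memLp_eval i).1 (memLp_eval j).1, integral_eval_stdGaussianVec, zero_mul]

theorem integral_dotProduct (u : ι → ℝ) :
    ∫ g : ι → ℝ, u ⬝ᵥ g ∂(stdGaussianVec ι) = 0 := by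
  simp only [dotProduct]
  rw [integral_finsetSum _ fun i _ => ((memLp_eval i).integrable (by norm_num)).const_mul _]
  simp [integral_const_mul, integral_eval_stdGaussianVec]

theorem integral_dotProduct_mul_dotProduct (u v : ι → ℝ) :
    ∫ g : ι → ℝ, (u ⬝ᵥ g) * (v ⬝ᵥ g) ∂(stdGaussianVec ι) = u ⬝ᵥ v := by
  classical
  have hi : ∀ i j, Integrable (fun g : ι → ℝ => u i * v j * (g i * g j)) (stdGaussianVec ι) :=
    fun i j => ((memLp_eval i).integrable_mul (memLp_eval j)).const_mul _
  have h : ∀ g : ι → ℝ, (u ⬝ᵥ g) * (v ⬝ᵥ g) = ∑ i, ∑ j, u i * v j * (g i * g j) := by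
    intro g
    simp only [dotProduct, Finset.sum_mul_sum]
    exact Finset.sum_congr rfl fun i _ => Finset.sum_congr rfl fun j _ => by ring
  simp_rw [h]
  rw [integral_finsetSum _ fun i _ => integrable_finsetSum _ fun j _ => hi i j]
  simp_rw [integral_finsetSum _ fun j _ => hi _ j, integral_const_mul, integral_eval_mul_eval]
  simp [dotProduct]

theorem integral_abs_dotProduct {u : ι → ℝ} (hu : u ⬝ᵥ u = 1) :
    ∫ g : ι → ℝ, |u ⬝ᵥ g| ∂(stdGaussianVec ι) = √(2 / Real.pi) := by
  have h := (hasGaussianLaw_dotProduct u).map_eq_gaussianReal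
  have hv : Var[fun g : ι → ℝ => u ⬝ᵥ g; stdGaussianVec ι] = 1 := by
    rw [variance_eq_sub (memLp_dotProduct u), integral_dotProduct]
    simp only [Pi.pow_apply, pow_two, integral_dotProduct_mul_dotProduct, hu]
    norm_num
  rw [hv, integral_dotProduct, Real.toNNReal_one] at h
  rw [← integral_abs_gaussianReal, ← h,
    integral_map (measurable_dotProduct u).aemeasurable continuous_abs.aestronglyMeasurable]

/-- The correlation of the sign of one Gaussian linear form with another linear form. -/
theorem integral_sgn_mul_dotProduct {u : ι → ℝ} (hu : u ⬝ᵥ u = 1) (v : ι → ℝ) :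
    ∫ g : ι → ℝ, sgn (u ⬝ᵥ g) * (v ⬝ᵥ g) ∂(stdGaussianVec ι) = √(2 / Real.pi) * (u ⬝ᵥ v) := by
  -- The part of `v` orthogonal to `u` gives a form independent of `⟨u, g⟩`, hence contributes zero;
  -- only the part along `u` survives.
  set w : ι → ℝ := v - (u ⬝ᵥ v) • u with hw
  have huw : u ⬝ᵥ w = 0 := by simp [hw, dotProduct_sub, hu]
  have hind : (fun g : ι → ℝ => u ⬝ᵥ g) ⟂ᵢ[stdGaussianVec ι] (fun g : ι → ℝ => w ⬝ᵥ g) := by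
    refine (hasGaussianLaw_dotProduct_prod u w).indepFun_of_covariance_eq_zero ?_
    rw [covariance_eq_sub (memLp_dotProduct u) (memLp_dotProduct w), integral_dotProduct,
      zero_mul, sub_zero]
    simp only [Pi.mul_apply, integral_dotProduct_mul_dotProduct, huw]
  have h0 : ∫ g : ι → ℝ, sgn (u ⬝ᵥ g) * (w ⬝ᵥ g) ∂(stdGaussianVec ι) = 0 := by
    refine ((hind.comp measurable_sgn measurable_id).integral_fun_mul_eq_mul_integral
      (memLp_sgn_dotProduct u).1 (memLp_dotProduct w).1).trans ?_
    simp [integral_dotProduct]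
  have hsplit : ∀ g : ι → ℝ, sgn (u ⬝ᵥ g) * (v ⬝ᵥ g)
      = (u ⬝ᵥ v) * |u ⬝ᵥ g| + sgn (u ⬝ᵥ g) * (w ⬝ᵥ g) := by
    intro g
    rw [← sgn_mul_self, hw, sub_dotProduct, smul_dotProduct, smul_eq_mul]
    ring
  simp_rw [hsplit]
  rw [integral_add, integral_const_mul, integral_abs_dotProduct hu, h0]
  · ring
  · exact (((memLp_dotProduct u).integrable (by norm_num)).abs).const_mul _
  · exact (memLp_sgn_dotProduct u).integrable_mul (memLp_dotProduct w)

end Linear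

/-! ### Perturbation bounds from the operator norm -/

theorem sum_entries_gram {ι κ : Type*} [Fintype ι] [Fintype κ] (C : Matrix ι ι ℝ) (U : Matrix ι κ ℝ) :
    ∑ i, ∑ j, C i j * (U i ⬝ᵥ U j) = ∑ k, (fun i => U i k) ⬝ᵥ C.mulVec (fun i => U i k) := by
  simp only [dotProduct, Matrix.mulVec, Finset.mul_sum]
  rw [Finset.sum_comm (γ := κ)]
  refine Finset.sum_congr rfl fun i _ => ?_
  rw [Finset.sum_comm]
  exact Finset.sum_congr rfl fun k _ => Finset.sum_congr rfl fun j _ => by ring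

section Bilinear

variable {ι : Type*} [Fintype ι] [DecidableEq ι]

theorem dotProduct_mulVec_le_opNorm (C : Matrix ι ι ℝ) (a b : ι → ℝ) :
    a ⬝ᵥ C.mulVec b ≤ opNorm C * (√(∑ i, a i ^ 2) * √(∑ i, b i ^ 2)) := by
  have h := real_inner_le_norm (WithLp.toLp 2 a)
    (Matrix.toEuclideanCLM (n := ι) (𝕜 := ℝ) C (WithLp.toLp 2 b))
  rw [Matrix.inner_toEuclideanCLM] at h
  have h2 := (Matrix.toEuclideanCLM (n := ι) (𝕜 := ℝ) C).le_opNorm (WithLp.toLp 2 b)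
  have ha : ‖WithLp.toLp 2 a‖ = √(∑ i, a i ^ 2) := by simp [EuclideanSpace.norm_eq]
  have hb : ‖WithLp.toLp 2 b‖ = √(∑ i, b i ^ 2) := by simp [EuclideanSpace.norm_eq]
  rw [hb] at h2
  rw [ha] at h
  refine h.trans ?_
  calc _ ≤ √(∑ i, a i ^ 2) * (opNorm C * √(∑ i, b i ^ 2)) :=
        mul_le_mul_of_nonneg_left h2 (Real.sqrt_nonneg _)
    _ = _ := by ring

/-- A bilinear form summed over families of vectors, bounded by Frobenius norms. -/
theorem sum_dotProduct_mulVec_le {κ : Type*} [Fintype κ] {C : Matrix ι ι ℝ} (hC : opNorm C = 1)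
    (a b : κ → ι → ℝ) :
    ∑ k, a k ⬝ᵥ C.mulVec (b k) ≤ √(∑ k, ∑ i, a k i ^ 2) * √(∑ k, ∑ i, b k i ^ 2) := by
  have h1 : ∀ k, a k ⬝ᵥ C.mulVec (b k) ≤ √(∑ i, a k i ^ 2) * √(∑ i, b k i ^ 2) := fun k => by
    simpa [hC] using dotProduct_mulVec_le_opNorm C (a k) (b k)
  refine (Finset.sum_le_sum fun k _ => h1 k).trans ?_
  refine (Real.sum_mul_le_sqrt_mul_sqrt _ _ _).trans (le_of_eq ?_)
  congr 2 <;> exact Finset.sum_congr rfl fun k _ =>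
    Real.sq_sqrt (Finset.sum_nonneg fun i _ => sq_nonneg _)

/-- Telescoping: `aᵀCa - bᵀCb = (a - b)ᵀCa + bᵀC(a - b)`, which needs no symmetry of `C`. -/
theorem sum_quadratic_sub_le {κ : Type*} [Fintype κ] {C : Matrix ι ι ℝ} (hC : opNorm C = 1)
    (a b : κ → ι → ℝ) :
    ∑ k, a k ⬝ᵥ C.mulVec (a k) - ∑ k, b k ⬝ᵥ C.mulVec (b k)
      ≤ √(∑ k, ∑ i, (a k i - b k i) ^ 2)
        * (√(∑ k, ∑ i, a k i ^ 2) + √(∑ k, ∑ i, b k i ^ 2)) := by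
  have h1 := sum_dotProduct_mulVec_le hC (fun k => a k - b k) a
  have h2 := sum_dotProduct_mulVec_le hC b (fun k => a k - b k)
  have h : ∑ k, a k ⬝ᵥ C.mulVec (a k) - ∑ k, b k ⬝ᵥ C.mulVec (b k)
      = ∑ k, (a k - b k) ⬝ᵥ C.mulVec (a k) + ∑ k, b k ⬝ᵥ C.mulVec (a k - b k) := by
    rw [← Finset.sum_sub_distrib, ← Finset.sum_add_distrib]
    refine Finset.sum_congr rfl fun k _ => ?_
    rw [sub_dotProduct, Matrix.mulVec_sub, dotProduct_sub]; ring
  rw [h]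
  simp only [Pi.sub_apply] at h1 h2
  nlinarith

/-- Stability of the value of Gram matrices under perturbation of the generating vectors. -/
theorem sum_gram_sub_le {κ : Type*} [Fintype κ] {C : Matrix ι ι ℝ} (hC : opNorm C = 1)
    (U V : Matrix ι κ ℝ) :
    ∑ i, ∑ j, C i j * (U i ⬝ᵥ U j) - ∑ i, ∑ j, C i j * (V i ⬝ᵥ V j)
      ≤ √(∑ i, ∑ k, (U i k - V i k) ^ 2) * (√(∑ i, U i ⬝ᵥ U i) + √(∑ i, V i ⬝ᵥ V i)) := by
  rw [sum_entries_gram, sum_entries_gram]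
  refine (sum_quadratic_sub_le hC (fun k i => U i k) (fun k i => V i k)).trans (le_of_eq ?_)
  simp only [dotProduct, ← pow_two]
  rw [Finset.sum_comm, Finset.sum_comm (f := fun k i => U i k ^ 2),
    Finset.sum_comm (f := fun k i => V i k ^ 2)]

end Bilinear

/-! ### The bipartite sign flip -/

theorem trace_mul_eq_sum {ι : Type*} [Fintype ι] (C : Matrix ι ι ℝ) {N : Matrix ι ι ℝ}
    (hN : N.IsHermitian) : (C * N).trace = ∑ i, ∑ j, C i j * N i j := by
  simp only [Matrix.trace, Matrix.diag, Matrix.mul_apply]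
  refine Finset.sum_congr rfl fun i _ => Finset.sum_congr rfl fun j _ => ?_
  rw [← hN.apply i j]; simp

/-- Flipping the signs on one side of the bipartition negates the objective, which gives a lower
bound for the objective at positive semidefinite matrices with diagonal entries in `{0, d}`. -/
theorem neg_optimum_le_sum {m : ℕ} (B : Matrix (Fin m) (Fin m) ℝ)
    {ρstar N : Matrix (Fin m ⊕ Fin m) (Fin m ⊕ Fin m) ℝ}
    (hopt : IsSDPOptimal (bipartiteCost B) ρstar) (hm : 0 < m) (hN : N.PosSemidef) {d : ℝ}
    (hd : 0 < d) (hdiag : ∀ i, N i i = 0 ∨ N i i = d) :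
    -(d * (Fintype.card (Fin m ⊕ Fin m) : ℝ) * (bipartiteCost B * ρstar).trace)
      ≤ ∑ i, ∑ j, bipartiteCost B i j * N i j := by
  set n : ℝ := (Fintype.card (Fin m ⊕ Fin m) : ℝ) with hn
  have hn0 : 0 < n := by rw [hn]; simp; omega
  set s : Fin m ⊕ Fin m → ℝ := Sum.elim (fun _ => 1) (fun _ => -1) with hs
  have hss : ∀ i, s i * s i = 1 := by rintro (i | i) <;> simp [hs]
  -- Flipped copy of `N`, padded on the diagonal to make it constant and then rescaled to be
  -- feasible. The padding is free because the cost vanishes on the diagonal.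
  set F : Matrix (Fin m ⊕ Fin m) (Fin m ⊕ Fin m) ℝ :=
    (d * n)⁻¹ • (Matrix.diagonal s * N * (Matrix.diagonal s).conjTranspose
      + Matrix.diagonal fun i => d - N i i) with hF
  have hpsd : F.PosSemidef := by
    refine Matrix.PosSemidef.smul (Matrix.PosSemidef.add
      (hN.mul_mul_conjTranspose_same _) (Matrix.PosSemidef.diagonal fun i => ?_)) (by positivity)
    rcases hdiag i with h | h <;> simp [h, hd.le]
  have happ : ∀ i j, F i j = (d * n)⁻¹ * (s i * N i j * s j + if i = j then d - N i i else 0) := by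
    intro i j
    simp [hF, Matrix.diagonal_apply, Matrix.diagonal_mul, mul_add]
  have hfeas : SDPFeasible F := by
    refine ⟨hpsd, fun i => ?_⟩
    rw [happ, if_pos rfl, show s i * N i i * s i = N i i by
      rw [mul_right_comm, hss, one_mul]]
    rw [← hn]; field_simp; ring
  have h := hopt.2 F hfeas
  rw [trace_mul_eq_sum _ hpsd.1] at h
  have hflip : ∀ i j, bipartiteCost B i j * F i j
      = -((d * n)⁻¹ * (bipartiteCost B i j * N i j)) := by
    intro i j
    rw [happ]
    rcases i with i | i <;> rcases j with j | j <;> simp [bipartiteCost, hs] <;> ring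
  simp_rw [hflip, Finset.sum_neg_distrib, ← Finset.mul_sum] at h
  have h' := mul_le_mul_of_nonneg_left h (by positivity : 0 ≤ d * n)
  rw [mul_neg, mul_inv_cancel_left₀ (by positivity)] at h'
  linarith

/-! ### Normalized rows, sign residuals and their Gram matrix -/

section Rounding

variable {ι : Type*} [Fintype ι]

/-- The vector `u` scaled to unit Euclidean length; the zero vector is left unchanged. -/
noncomputable def unitVec (u : ι → ℝ) : ι → ℝ := (√(u ⬝ᵥ u))⁻¹ • u

theorem dotProduct_self_pos {u : ι → ℝ} (hu : u ≠ 0) : 0 < u ⬝ᵥ u :=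
  lt_of_le_of_ne (Finset.sum_nonneg fun _ _ => mul_self_nonneg _)
    (Ne.symm (mt dotProduct_self_eq_zero.mp hu))

theorem unitVec_zero : unitVec (0 : ι → ℝ) = 0 := by simp [unitVec]

theorem unitVec_dotProduct_self {u : ι → ℝ} (hu : u ≠ 0) : unitVec u ⬝ᵥ unitVec u = 1 := by
  have h := dotProduct_self_pos hu
  have h1 := Real.mul_self_sqrt h.le
  have h2 := Real.sqrt_pos.mpr h
  simp only [unitVec, smul_dotProduct, dotProduct_smul, smul_eq_mul]
  field_simp
  linarith

theorem unitVec_dotProduct_self_le (u : ι → ℝ) : unitVec u ⬝ᵥ unitVec u ≤ 1 := by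
  by_cases hu : u = 0
  · simp [hu, unitVec_zero]
  · exact (unitVec_dotProduct_self hu).le

theorem sgn_unitVec_dotProduct {u : ι → ℝ} (hu : u ≠ 0) (g : ι → ℝ) :
    sgn (unitVec u ⬝ᵥ g) = sgn (u ⬝ᵥ g) := by
  rw [unitVec, smul_dotProduct, smul_eq_mul,
    sgn_pos_mul (inv_pos.mpr (Real.sqrt_pos.mpr (dotProduct_self_pos hu)))]

/-- With `q = ‖u‖ > 0`, the left side is `(tq - 1)²`, and `|tq - 1| ≤ tq + 1` turns it into `|t²q² -
1|`. Thus an ℓ¹ bound on the diagonal controls squared Euclidean distances. -/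
theorem sum_unitVec_sub_sq_le (u : ι → ℝ) {t : ℝ} (ht : 0 ≤ t) :
    ∑ k, (unitVec u k - t * u k) ^ 2 ≤ |t ^ 2 * (u ⬝ᵥ u) - 1| := by
  by_cases hu : u = 0
  · simp [hu, unitVec_zero]
  · have h := dotProduct_self_pos hu
    set q := √(u ⬝ᵥ u) with hq
    have hq0 : 0 < q := Real.sqrt_pos.mpr h
    have hqq : u ⬝ᵥ u = q ^ 2 := (Real.sq_sqrt h.le).symm
    have hs : ∑ k, (unitVec u k - t * u k) ^ 2 = (q⁻¹ - t) ^ 2 * (u ⬝ᵥ u) := by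
      simp only [dotProduct, Finset.mul_sum]
      refine Finset.sum_congr rfl fun k _ => ?_
      simp only [unitVec, ← hq, Pi.smul_apply, smul_eq_mul]
      ring
    have hs2 : (q⁻¹ - t) ^ 2 * (u ⬝ᵥ u) = |t * q - 1| ^ 2 := by
      rw [hqq, sq_abs]; field_simp; ring
    rw [hs, hs2, hqq, show t ^ 2 * q ^ 2 - 1 = (t * q - 1) * (t * q + 1) by ring, abs_mul, pow_two]
    refine mul_le_mul_of_nonneg_left ?_ (abs_nonneg _)
    have : 0 ≤ t * q := by positivity
    rw [abs_of_nonneg (by positivity : 0 ≤ t * q + 1), abs_le]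
    constructor <;> linarith

open Classical in
/-- The sign of the Gaussian linear form `u`, replaced by `0` when `u = 0`. -/
noncomputable def signForm (u g : ι → ℝ) : ℝ := if u = 0 then 0 else sgn (u ⬝ᵥ g)

theorem memLp_signForm (u : ι → ℝ) : MemLp (signForm u) 2 (stdGaussianVec ι) := by
  by_cases hu : u = 0
  · have : signForm u = fun _ => 0 := by ext g; simp [signForm, hu]
    rw [this]
    exact MemLp.zero'
  · have : signForm u = fun g => sgn (u ⬝ᵥ g) := by ext g; simp [signForm, hu]
    rw [this]
    exact memLp_sgn_dotProduct u

theorem integral_signForm_mul_dotProduct (u v : ι → ℝ) :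
    ∫ g, signForm u g * (v ⬝ᵥ g) ∂(stdGaussianVec ι)
      = √(2 / Real.pi) * (unitVec u ⬝ᵥ v) := by
  by_cases hu : u = 0
  · simp [signForm, hu, unitVec_zero]
  · rw [← integral_sgn_mul_dotProduct (unitVec_dotProduct_self hu)]
    simp only [signForm, if_neg hu, sgn_unitVec_dotProduct hu]

/-- The component of `signForm u` orthogonal to all Gaussian linear forms. -/
noncomputable def signResidual (u g : ι → ℝ) : ℝ :=
  signForm u g - √(2 / Real.pi) * (unitVec u ⬝ᵥ g)

theorem memLp_signResidual (u : ι → ℝ) : MemLp (signResidual u) 2 (stdGaussianVec ι) :=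
  (memLp_signForm u).sub ((memLp_dotProduct _).const_mul _)

/-- Both cross terms equal `(2/π) ⟨û, v̂⟩`, as does the product of the linear parts, so exactly one
copy remains subtracted. -/
theorem integral_signResidual_mul (u v : ι → ℝ) :
    ∫ g, signResidual u g * signResidual v g ∂(stdGaussianVec ι)
      = ∫ g, signForm u g * signForm v g ∂(stdGaussianVec ι)
        - 2 / Real.pi * (unitVec u ⬝ᵥ unitVec v) := by
  have hc : √(2 / Real.pi) * √(2 / Real.pi) = 2 / Real.pi :=
    Real.mul_self_sqrt (by positivity)
  have h : ∀ g, signResidual u g * signResidual v g = signForm u g * signForm v g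
      - √(2 / Real.pi) * (signForm u g * (unitVec v ⬝ᵥ g))
      - √(2 / Real.pi) * (signForm v g * (unitVec u ⬝ᵥ g))
      + 2 / Real.pi * ((unitVec u ⬝ᵥ g) * (unitVec v ⬝ᵥ g)) := by
    intro g
    unfold signResidual
    linear_combination (unitVec u ⬝ᵥ g) * (unitVec v ⬝ᵥ g) * hc
  have i1 := (memLp_signForm u).integrable_mul (memLp_signForm v)
  have i2 := ((memLp_signForm u).integrable_mul (memLp_dotProduct (unitVec v))).const_mul
    √(2 / Real.pi)
  have i3 := ((memLp_signForm v).integrable_mul (memLp_dotProduct (unitVec u))).const_mul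
    √(2 / Real.pi)
  have i4 := ((memLp_dotProduct (unitVec u)).integrable_mul
    (memLp_dotProduct (unitVec v))).const_mul (2 / Real.pi)
  simp_rw [h]
  have e1 := integral_add ((i1.sub i2).sub i3) i4
  have e2 := integral_sub (i1.sub i2) i3
  have e3 := integral_sub i1 i2
  simp only [Pi.mul_apply, Pi.sub_apply] at e1 e2 e3
  rw [e1, e2, e3]
  simp only [integral_const_mul, integral_signForm_mul_dotProduct,
    integral_dotProduct_mul_dotProduct]
  rw [dotProduct_comm (unitVec v) (unitVec u), ← mul_assoc √(2 / Real.pi), hc]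
  ring

theorem integral_signForm_mul_self {u : ι → ℝ} (hu : u ≠ 0) :
    ∫ g, signForm u g * signForm u g ∂(stdGaussianVec ι) = 1 := by
  have h : ∀ g, signForm u g * signForm u g = 1 := fun g => by
    rw [signForm, if_neg hu]
    rcases sgn_eq_one_or (u ⬝ᵥ g) with h | h <;> simp [h]
  simp [h]

/-- The second moments of the sign residuals. -/
noncomputable def residualGram (U : Matrix ι ι ℝ) : Matrix ι ι ℝ :=
  Matrix.of fun i j => ∫ g, signResidual (U i) g * signResidual (U j) g ∂(stdGaussianVec ι)

theorem posSemidef_residualGram (U : Matrix ι ι ℝ) : (residualGram U).PosSemidef := by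
  refine Matrix.PosSemidef.of_dotProduct_mulVec_nonneg ?_ fun x => ?_
  · ext i j
    simp [residualGram, mul_comm]
  · have hint : ∀ i j, Integrable (fun g => x i * x j *
        (signResidual (U i) g * signResidual (U j) g)) (stdGaussianVec ι) := fun i j =>
      ((memLp_signResidual (U i)).integrable_mul (memLp_signResidual (U j))).const_mul _
    have h : star x ⬝ᵥ (residualGram U).mulVec x
        = ∫ g, (∑ i, x i * signResidual (U i) g) ^ 2 ∂(stdGaussianVec ι) := by
      have hs : ∀ g, (∑ i, x i * signResidual (U i) g) ^ 2
          = ∑ i, ∑ j, x i * x j * (signResidual (U i) g * signResidual (U j) g) := fun g => by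
        rw [pow_two, Finset.sum_mul_sum]
        exact Finset.sum_congr rfl fun i _ => Finset.sum_congr rfl fun j _ => by ring
      simp_rw [hs]
      rw [integral_finsetSum _ fun i _ => integrable_finsetSum _ fun j _ => hint i j]
      simp_rw [integral_finsetSum _ fun j _ => hint _ j, integral_const_mul]
      simp only [dotProduct, Matrix.mulVec, Finset.mul_sum, residualGram, Matrix.of_apply,
        star_trivial]
      exact Finset.sum_congr rfl fun i _ => Finset.sum_congr rfl fun j _ => by ring
    rw [h]
    exact integral_nonneg fun g => sq_nonneg _

/-- The value 0 arises only at vanishing rows. There `sgn 0 = 1` would give a residual of second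
moment 1, too large for the diagonal padding in `neg_optimum_le_sum`; this is why `signForm` is 0
there. -/
theorem residualGram_diag (U : Matrix ι ι ℝ) (i : ι) :
    residualGram U i i = 0 ∨ residualGram U i i = 1 - 2 / Real.pi := by
  by_cases hu : U i = 0
  · left
    simp [residualGram, hu, signResidual, signForm, unitVec_zero]
  · right
    simp only [residualGram, Matrix.of_apply]
    rw [integral_signResidual_mul, integral_signForm_mul_self hu, unitVec_dotProduct_self hu,
      mul_one]

theorem integral_signForm_quadratic (C U : Matrix ι ι ℝ) :
    ∫ g, (fun i => signForm (U i) g) ⬝ᵥ C.mulVec (fun i => signForm (U i) g)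
        ∂(stdGaussianVec ι)
      = ∑ i, ∑ j, C i j * residualGram U i j
        + 2 / Real.pi * ∑ i, ∑ j, C i j * (unitVec (U i) ⬝ᵥ unitVec (U j)) := by
  have hint : ∀ i j, Integrable (fun g => C i j * (signForm (U i) g * signForm (U j) g))
      (stdGaussianVec ι) := fun i j =>
    ((memLp_signForm (U i)).integrable_mul (memLp_signForm (U j))).const_mul _
  have hs : ∀ g, (fun i => signForm (U i) g) ⬝ᵥ C.mulVec (fun i => signForm (U i) g)
      = ∑ i, ∑ j, C i j * (signForm (U i) g * signForm (U j) g) := fun g => by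
    simp only [dotProduct, Matrix.mulVec, Finset.mul_sum]
    exact Finset.sum_congr rfl fun i _ => Finset.sum_congr rfl fun j _ => by ring
  simp_rw [hs]
  rw [integral_finsetSum _ fun i _ => integrable_finsetSum _ fun j _ => hint i j]
  simp_rw [integral_finsetSum _ fun j _ => hint _ j, integral_const_mul, Finset.mul_sum,
    ← Finset.sum_add_distrib]
  refine Finset.sum_congr rfl fun i _ => Finset.sum_congr rfl fun j _ => ?_
  simp only [residualGram, Matrix.of_apply, integral_signResidual_mul]
  ring

theorem integrable_signForm_quadratic (C U : Matrix ι ι ℝ) :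
    Integrable (fun g => (fun i => signForm (U i) g) ⬝ᵥ C.mulVec (fun i => signForm (U i) g))
      (stdGaussianVec ι) := by
  simp only [dotProduct, Matrix.mulVec, Finset.mul_sum]
  refine integrable_finsetSum _ fun i _ => integrable_finsetSum _ fun j _ => ?_
  refine (((memLp_signForm (U i)).integrable_mul (memLp_signForm (U j))).const_mul (C i j)).congr
    (Filter.Eventually.of_forall fun g => ?_)
  simp only [Pi.mul_apply]
  ring

end Rounding

/-! ### Error estimates for vanishing rows and for normalization -/

/-- Replacing the rounded signs of vanishing rows by `0` changes the objective only slightly. -/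
theorem signForm_quadratic_sub_le {ι : Type*} [Fintype ι] [DecidableEq ι] {C : Matrix ι ι ℝ}
    (hC : opNorm C = 1) (U : Matrix ι ι ℝ) (g : ι → ℝ) {δ : ℝ}
    (hdiag : ∑ i, |(Fintype.card ι : ℝ) * (U i ⬝ᵥ U i) - 1| ≤ δ) :
    (fun i => signForm (U i) g) ⬝ᵥ C.mulVec (fun i => signForm (U i) g)
        - (fun i => sgn (U i ⬝ᵥ g)) ⬝ᵥ C.mulVec (fun i => sgn (U i ⬝ᵥ g))
      ≤ √δ * (2 * √(Fintype.card ι)) := by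
  have h := sum_quadratic_sub_le (κ := Unit) hC (fun _ i => signForm (U i) g)
    (fun _ i => sgn (U i ⬝ᵥ g))
  simp only [Finset.univ_unique, Finset.sum_singleton] at h
  refine h.trans ?_
  have hsq : ∀ t, sgn t ^ 2 = 1 := fun t => by rw [← sq_abs, abs_sgn, one_pow]
  -- Each vanishing row costs 1 here and also contributes exactly 1 to the diagonal deviation.
  have h1 : ∑ i, (signForm (U i) g - sgn (U i ⬝ᵥ g)) ^ 2 ≤ δ := by
    refine (Finset.sum_le_sum fun i _ => ?_).trans hdiag
    by_cases hu : U i = 0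
    · simp [signForm, hu, hsq]
    · simp [signForm, hu]
  have h2 : ∑ i, signForm (U i) g ^ 2 ≤ (Fintype.card ι : ℝ) := by
    refine (Finset.sum_le_sum (g := fun _ => (1 : ℝ)) fun i _ => ?_).trans (by simp)
    by_cases hu : U i = 0
    · simp [signForm, hu]
    · simp [signForm, hu, hsq]
  have h3 : ∑ i, sgn (U i ⬝ᵥ g) ^ 2 = (Fintype.card ι : ℝ) := by simp [hsq]
  rw [h3]
  refine mul_le_mul (Real.sqrt_le_sqrt h1) ?_ (by positivity) (by positivity)
  linarith [Real.sqrt_le_sqrt h2]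

theorem scaled_sum_sub_unitVec_le {ι : Type*} [Fintype ι] [DecidableEq ι] {C : Matrix ι ι ℝ}
    (hC : opNorm C = 1) (U : Matrix ι ι ℝ) {δ : ℝ}
    (hdiag : ∑ i, |(Fintype.card ι : ℝ) * (U i ⬝ᵥ U i) - 1| ≤ δ) :
    (Fintype.card ι : ℝ) * ∑ i, ∑ j, C i j * (U i ⬝ᵥ U j)
        - ∑ i, ∑ j, C i j * (unitVec (U i) ⬝ᵥ unitVec (U j))
      ≤ √δ * (√(Fintype.card ι + δ) + √(Fintype.card ι)) := by
  set t := √(Fintype.card ι : ℝ) with ht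
  have htt : t * t = (Fintype.card ι : ℝ) := Real.mul_self_sqrt (by positivity)
  -- Scaling by `√n` makes the expected squared row length 1, the length of the normalized rows.
  let V : Matrix ι ι ℝ := fun i => t • U i
  have h := sum_gram_sub_le hC V (fun i => unitVec (U i))
  have hg : ∀ i j, V i ⬝ᵥ V j = (Fintype.card ι : ℝ) * (U i ⬝ᵥ U j) := fun i j => by
    rw [← htt]
    simp only [V, smul_dotProduct, dotProduct_smul, smul_eq_mul]
    ring
  simp only [hg] at h
  have hl : ∑ i, ∑ j, C i j * ((Fintype.card ι : ℝ) * (U i ⬝ᵥ U j))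
      = (Fintype.card ι : ℝ) * ∑ i, ∑ j, C i j * (U i ⬝ᵥ U j) := by
    simp only [Finset.mul_sum]
    exact Finset.sum_congr rfl fun i _ => Finset.sum_congr rfl fun j _ => by ring
  rw [hl] at h
  refine h.trans ?_
  have h1 : ∑ i, ∑ k, (V i k - unitVec (U i) k) ^ 2 ≤ δ := by
    refine (Finset.sum_le_sum fun i _ => ?_).trans hdiag
    have := sum_unitVec_sub_sq_le (U i) (Real.sqrt_nonneg (Fintype.card ι : ℝ))
    rw [Real.sq_sqrt (by positivity)] at this
    refine le_trans (le_of_eq (Finset.sum_congr rfl fun k _ => ?_)) this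
    simp only [V, Pi.smul_apply, smul_eq_mul, ← ht]
    ring
  have h2 : ∑ i, (Fintype.card ι : ℝ) * (U i ⬝ᵥ U i) ≤ Fintype.card ι + δ := by
    have : ∑ i, ((Fintype.card ι : ℝ) * (U i ⬝ᵥ U i) - 1) ≤ δ :=
      (Finset.sum_le_sum fun i _ => le_abs_self _).trans hdiag
    rw [Finset.sum_sub_distrib] at this
    simp only [Finset.sum_const, Finset.card_univ, nsmul_eq_mul, mul_one] at this
    linarith
  have h3 : ∑ i, unitVec (U i) ⬝ᵥ unitVec (U i) ≤ (Fintype.card ι : ℝ) :=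
    (Finset.sum_le_sum fun i _ => unitVec_dotProduct_self_le (U i)).trans (by simp)
  exact mul_le_mul (Real.sqrt_le_sqrt h1)
    (add_le_add (Real.sqrt_le_sqrt h2) (Real.sqrt_le_sqrt h3)) (by positivity) (by positivity)

/-! ### Assembly of the bound -/

theorem mainTheorem3 :
    ∃ K : ℝ, 0 < K ∧
      ∀ (m n : ℕ) (_hn : n = 2 * m)
        (B : Matrix (Fin m) (Fin m) ℝ) (C : Matrix (Fin m ⊕ Fin m) (Fin m ⊕ Fin m) ℝ)
        (_hC : C = bipartiteCost B) (_hnorm : opNorm C = 1)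
        (ρstar : Matrix (Fin m ⊕ Fin m) (Fin m ⊕ Fin m) ℝ) (_hopt : IsSDPOptimal C ρstar)
        (ρ : Matrix (Fin m ⊕ Fin m) (Fin m ⊕ Fin m) ℝ) (_hρ : ρ.PosSemidef)
        (ε : ℝ) (_hε0 : 0 ≤ ε) (_hε : ε ≤ 1 / 2)
        (_hobj : (C * ρstar).trace - (C * ρ).trace ≤ ε)
        (_hdiag : ∑ i, |ρ i i - 1 / (n : ℝ)| ≤ ε),
        (4 / Real.pi - 1) * (n : ℝ) * (C * ρstar).trace - K * ((n : ℝ) * ε ^ (1 / 3 : ℝ))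
          ≤ expectedRoundedValue C ρ := by
  -- `6 = 2 + 3 + 1`: vanishing rows (`hE1`), normalization (`hE2`) and suboptimality of `ρ`
  -- (`hE3`); the factor `2/π` on the last two is bounded by 1.
  refine ⟨6, by norm_num, ?_⟩
  intro m n hn B C hC hnorm ρstar hopt ρ hρ ε hε0 hε hobj hdiag
  -- For `m = 0` the operator norm would be 0, not 1.
  have hm : 0 < m := by
    rcases Nat.eq_zero_or_pos m with rfl | h
    · have : ‖Matrix.toEuclideanCLM (n := Fin 0 ⊕ Fin 0) (𝕜 := ℝ) C‖ = 0 := by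
        rw [Subsingleton.elim C 0, map_zero, norm_zero]
      rw [opNorm, this] at hnorm
      norm_num at hnorm
    · exact h
  have hcard : (Fintype.card (Fin m ⊕ Fin m) : ℝ) = n := by
    simp [hn, two_mul]
  have hn0 : (0 : ℝ) < n := by rw [hn]; exact_mod_cast (by omega : 0 < 2 * m)
  set A := CFC.sqrt ρ with hA
  have hAh : A.IsHermitian := (Matrix.nonneg_iff_posSemidef.mp (CFC.sqrt_nonneg ρ)).1
  have hAA : A * A = ρ := CFC.sqrt_mul_sqrt_self ρ hρ.nonneg
  have hgram : ∀ i j, A i ⬝ᵥ A j = ρ i j := fun i j => by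
    rw [← hAA, Matrix.mul_apply]
    refine Finset.sum_congr rfl fun k _ => ?_
    rw [← hAh.apply k j]; simp
  have hdiag' : ∑ i, |(Fintype.card (Fin m ⊕ Fin m) : ℝ) * (A i ⬝ᵥ A i) - 1| ≤ n * ε := by
    refine le_trans (le_of_eq ?_) (mul_le_mul_of_nonneg_left hdiag hn0.le)
    rw [Finset.mul_sum]
    refine Finset.sum_congr rfl fun i _ => ?_
    rw [hgram, hcard, ← abs_of_pos hn0, ← abs_mul, abs_of_pos hn0]
    congr 1
    field_simp
  have hpi : 2 / Real.pi < 1 := by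
    rw [div_lt_one Real.pi_pos]; linarith [Real.pi_gt_three]
  have hres := neg_optimum_le_sum B (hC ▸ hopt) hm (posSemidef_residualGram A)
    (sub_pos.mpr hpi) (residualGram_diag A)
  rw [← hC, hcard] at hres
  have hnrm := scaled_sum_sub_unitVec_le hnorm A hdiag'
  simp only [hgram] at hnrm
  rw [← trace_mul_eq_sum C hρ.1, hcard] at hnrm
  have hexp : ∫ g, (fun i => signForm (A i) g) ⬝ᵥ C.mulVec (fun i => signForm (A i) g)
      ∂(stdGaussianVec _) - √(n * ε) * (2 * √n) ≤ expectedRoundedValue C ρ := by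
    have h1 := integral_mono
      ((integrable_signForm_quadratic C A).sub (integrable_const (√(n * ε) * (2 * √(n : ℝ)))))
      (integrable_roundedValue C ρ) fun g => by
        have := signForm_quadratic_sub_le hnorm A g hdiag'
        rw [hcard] at this
        have h2 : signRound ρ g = fun i => sgn (A i ⬝ᵥ g) := rfl
        simp only [h2, Pi.sub_apply]
        linarith
    simp only [Pi.sub_apply] at h1
    rw [integral_sub (integrable_signForm_quadratic C A) (integrable_const _)] at h1
    simp only [integral_const, probReal_univ, one_smul] at h1
    exact h1
  rw [integral_signForm_quadratic] at hexp
  set e := ε ^ (1 / 3 : ℝ) with he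
  have he0 : 0 ≤ e := Real.rpow_nonneg hε0 _
  have hε1 : ε ≤ 1 := by linarith
  have hεe : ε ≤ e := by
    have := Real.rpow_le_rpow_of_exponent_ge' hε0 hε1 (by norm_num)
      (by norm_num : (1 / 3 : ℝ) ≤ 1)
    rwa [Real.rpow_one] at this
  -- The only place where the exponent is weakened from `1/2` to `1/3`; it uses `ε ≤ 1`.
  have hse : √ε ≤ e := by
    rw [Real.sqrt_eq_rpow]
    exact Real.rpow_le_rpow_of_exponent_ge' hε0 hε1 (by norm_num) (by norm_num)
  have hsn : √(n : ℝ) * √n = n := Real.mul_self_sqrt hn0.le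
  have hδ : √(n * ε) = √n * √ε := Real.sqrt_mul hn0.le _
  have hr : √(n + n * ε) ≤ 2 * √n := by
    rw [Real.sqrt_le_left (by positivity), mul_pow, Real.sq_sqrt hn0.le]
    nlinarith
  have hE1 : √(n * ε) * (2 * √n) ≤ 2 * (n * e) := by
    rw [hδ]
    calc _ = 2 * ((√n * √n) * √ε) := by ring
      _ ≤ _ := by rw [hsn]; gcongr
  have hE2 : √(n * ε) * (√(n + n * ε) + √n) ≤ 3 * (n * e) := by
    calc _ ≤ √(n * ε) * (2 * √n + √n) := by gcongr
      _ = 3 / 2 * (√(n * ε) * (2 * √n)) := by ring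
      _ ≤ _ := by linarith
  have hE3 : n * (C * ρstar).trace - n * (C * ρ).trace ≤ n * e := by
    rw [← mul_sub]
    exact mul_le_mul_of_nonneg_left (hobj.trans hεe) hn0.le
  have hY : n * (C * ρstar).trace - 4 * (n * e)
      ≤ ∑ i, ∑ j, C i j * (unitVec (A i) ⬝ᵥ unitVec (A j)) := by linarith
  have hY' := mul_le_mul_of_nonneg_left hY (by positivity : 0 ≤ 2 / Real.pi)
  have hne : 2 / Real.pi * (4 * (n * e)) ≤ 4 * (n * e) :=
    mul_le_of_le_one_left (by positivity) hpi.le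
  have h4 : 4 / Real.pi = 2 * (2 / Real.pi) := by ring
  rw [h4]
  nlinarith
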